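/- **Setting.** All graphs are finite, simple and undirected. For vertices $s\ne t$ of a graph $H$, the resistance distance $\Omega_{s,t}(H)$ is the effective resistance between $s$ and $t$ when every edge of $H$ is a unit resistor ($\infty$ if no current can flow). The vertices $s,t$ are *$k$-edge-connected* in $H$ if there are $k$ pairwise edge-disjoint paths from $s$ to $t$. The *bipartite double graph* $G_b$ of $G$ has two vertices $v_{\rm out},v_{\rm in}$ for each vertex $v$ of $G$ and two edges $\{u_{\rm out},v_{\rm in}\},\{v_{\rm out},u_{\rm in}\}$ for each edge $\{u,v\}$ of $G$. For a connected $d$-regular graph $G$ with $N$ vertices, the quantum walk acts on the Hilbert space with orthonormal basis $|uv\rangle$, $(u,v)$ ranging over the directed edges of $G$ (so $|uv\rangle$ is the walker at $u$ pointing to $v$, and the space is $\mathbb C^N\otimes\mathbb C^d$), by $U=S\,(I_N\otimes C)$, where $C=2|s_c\rangle\langle s_c|-I_d$ is the Grover coin, $|s_c\rangle$ the equal superposition of the $d$ directions, and $S|uv\rangle=|vu\rangle$. **Theorem.** There is an absolute constant $K>0$ such that the following hold for every integer $k\ge 1$. 1. *(Resistance.)* Let $s\neq t$ be vertices of a graph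 $H$ with $N$ vertices. (a) If $s,t$ are $k$-edge-connected in $H$, and $s,t$ are adjacent or $k\ge N^{2/3}$, then $\Omega_{s,t}(H)\le K N^{2/3}/k$. (b) If there are $k$ pairwise edge-disjoint paths from $s$ to $t$ of lengths $\ell_1,\dots,\ell_k$, then $\Omega_{s,t}(H)\le 1/\sum_{i=1}^k \frac1{\ell_i}$. 2. Let $G$ be a connected $d$-regular graph with $N$ vertices and $\{a,b\}$ an edge of $G$. *(Oscillatory localization between $|ab\rangle$ and $-|ba\rangle$.)* If $a_{\rm out}$ and $b_{\rm in}$ are $k$-edge-connected in $G_b$, then for all $t\ge 0$ $$|\langle ab|U^{2t}|ab\rangle|\ \ge\ 1-c,\qquad |\langle -ba|U^{2t+1}|ab\rangle|\ \ge\ 1-c,\qquad c=\frac{2K(2N)^{2/3}}{k},$$ where $|{-ba}\rangle=-|ba\rangle$; the same holds with $c=2/\sum_{i=1}^k\frac1{\ell_i}$ if there are $k$ pairwise edge-disjoint paths from $a_{\rm out}$ to $b_{\rm in}$ in $G_b$ of lengths $\ell_1,\dots,\ell_k$. *(Stationarity.)* If $a$ and $b$ are $k$-edge-connected in $G$, then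 the state $|\psi_0\rangle=(|ab\rangle-|ba\rangle)/\sqrt2$ satisfies $|\langle\psi_0|U^{t}|\psi_0\rangle|\ge 1-c$ for all $t\ge0$ with $c=2KN^{2/3}/k$; the same holds with $c=2/\sum_{i=1}^k\frac1{\ell_i}$ if there are $k$ pairwise edge-disjoint paths from $a$ to $b$ in $G$ of lengths $\ell_1,\dots,\ell_k$. -/

import Mathlib

open scoped ENNReal

universe u

noncomputable section

namespace OscLoc

variable {V : Type u}

/-! ### Electric networks -/

/-- `p` is a potential of the electric network in which every edge of `G` is a unit resistor, one unit
of current is injected at `s` and one unit is extracted at `t`. By Ohm's law the current from `v` to a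
neighbour `w` is `p v - p w`; the equation is Kirchhoff's current law. -/
def IsUnitCurrentPotential [Fintype V] [DecidableEq V] (G : SimpleGraph V) [DecidableRel G.Adj]
    (s t : V) (p : V → ℝ) : Prop :=
  ∀ v, ∑ w ∈ G.neighborFinset v, (p v - p w) =
    (if v = s then (1 : ℝ) else 0) - (if v = t then (1 : ℝ) else 0)

/-- The resistance distance `Ω_{s,t}`: the potential difference that drives a unit current from `s`
to `t`, or `∞` if no current can flow. The difference does not depend on the potential chosen, see
`resistanceDist_eq`. -/
def resistanceDist [Fintype V] [DecidableEq V] (G : SimpleGraph V) [DecidableRel G.Adj]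
    (s t : V) : ℝ≥0∞ :=
  ⨅ (p : V → ℝ) (_ : IsUnitCurrentPotential G s t p), ENNReal.ofReal (p s - p t)

theorem IsUnitCurrentPotential.drop_eq [Fintype V] [DecidableEq V] {G : SimpleGraph V}
    [DecidableRel G.Adj] {s t : V} {p q : V → ℝ} (hp : IsUnitCurrentPotential G s t p)
    (hq : IsUnitCurrentPotential G s t q) : p s - p t = q s - q t := by
  have key : ∀ x y : V → ℝ, IsUnitCurrentPotential G s t y →
      ∑ v, ∑ w, (if G.Adj v w then x v * (y v - y w) else 0) = x s - x t := by
    intro x y hy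
    have h1 : ∀ v, ∑ w, (if G.Adj v w then x v * (y v - y w) else 0) =
        x v * ((if v = s then (1 : ℝ) else 0) - (if v = t then (1 : ℝ) else 0)) := by
      intro v
      rw [← hy v, Finset.mul_sum, ← Finset.sum_filter, SimpleGraph.neighborFinset_eq_filter]
    rw [Finset.sum_congr rfl fun v _ => h1 v]
    simp only [mul_sub, Finset.sum_sub_distrib, mul_ite, mul_one, mul_zero,
      Finset.sum_ite_eq', Finset.mem_univ, if_true]
  have hsymm : ∑ v, ∑ w, (if G.Adj v w then p v * q w else 0) =
      ∑ v, ∑ w, (if G.Adj v w then q v * p w else 0) := by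
    rw [Finset.sum_comm]
    refine Finset.sum_congr rfl fun v _ => Finset.sum_congr rfl fun w _ => ?_
    simp only [G.adj_comm w v, mul_comm]
  rw [← key p q hq, ← key q p hp]
  have e : ∀ x y : V → ℝ, ∑ v, ∑ w, (if G.Adj v w then x v * (y v - y w) else 0) =
      ∑ v, ∑ w, (if G.Adj v w then x v * y v else 0) -
        ∑ v, ∑ w, (if G.Adj v w then x v * y w else 0) := by
    intro x y
    simp only [← Finset.sum_sub_distrib]
    refine Finset.sum_congr rfl fun v _ => Finset.sum_congr rfl fun w _ => ?_
    split_ifs <;> ring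
  rw [e p q, e q p, hsymm]
  simp only [mul_comm]

theorem resistanceDist_eq [Fintype V] [DecidableEq V] {G : SimpleGraph V}
    [DecidableRel G.Adj] {s t : V} {p : V → ℝ} (hp : IsUnitCurrentPotential G s t p) :
    resistanceDist G s t = ENNReal.ofReal (p s - p t) := by
  refine le_antisymm (iInf₂_le p hp) (le_iInf₂ fun q hq => ?_)
  rw [hp.drop_eq hq]

/-! ### Edge-connectivity of two vertices -/

/-- The paths `P i` are pairwise edge-disjoint. -/
def EdgeDisjoint {G : SimpleGraph V} {s t : V} {k : ℕ} (P : Fin k → G.Path s t) : Prop :=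
  ∀ i j, i ≠ j → List.Disjoint (P i).1.edges (P j).1.edges

/-- `s` and `t` are `k`-edge-connected: there are `k` edge-disjoint paths from `s` to `t`. -/
def EdgeConnectedPair (G : SimpleGraph V) (s t : V) (k : ℕ) : Prop :=
  ∃ P : Fin k → G.Path s t, EdgeDisjoint P

/-- The resistance of resistors of sizes equal to the lengths of the paths, connected in parallel:
`1 / ∑ i, 1 / ℓ i`. -/
def parallelResistance {G : SimpleGraph V} {s t : V} {k : ℕ} (P : Fin k → G.Path s t) : ℝ :=
  1 / ∑ i, 1 / ((P i).1.length : ℝ)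

/-- The bipartite double graph `G_b`: `Sum.inl v` is `v_out` and `Sum.inr v` is `v_in`; every edge
`{u, v}` of `G` gives the two edges `{u_out, v_in}` and `{v_out, u_in}`. -/
def bipartiteDouble (G : SimpleGraph V) : SimpleGraph (V ⊕ V) where
  Adj
    | Sum.inl u, Sum.inr v => G.Adj u v
    | Sum.inr v, Sum.inl u => G.Adj u v
    | _, _ => False
  symm := ⟨by rintro (u | u) (v | v) h <;> exact h⟩
  loopless := ⟨by rintro (u | u) h <;> exact h⟩

/-! ### The quantum walk -/

section Walk

variable [Fintype V] [DecidableEq V] (G : SimpleGraph V) [DecidableRel G.Adj]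

/-- The state space of the walk. The orthonormal basis is indexed by the directed edges; the basis
vector of `(u, v)` is `|uv⟩ = |u⟩ ⊗ |u → v⟩`, the walker at `u` pointing towards `v`. -/
abbrev WalkSpace : Type u := EuclideanSpace ℂ G.Dart

variable {G} in
/-- The basis state `|ab⟩`. -/
def ket {a b : V} (h : G.Adj a b) : WalkSpace G :=
  EuclideanSpace.single (⟨(a, b), h⟩ : G.Dart) (1 : ℂ)

/-- `|u⟩ ⊗ |s_c⟩`, where `|s_c⟩` is the equal superposition of the `d` directions. -/
def coinState (d : ℕ) (u : V) : WalkSpace G :=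
  WithLp.toLp 2 fun e => if e.fst = u then ((1 / Real.sqrt d : ℝ) : ℂ) else 0

/-- `I_N ⊗ C` for the Grover coin `C = 2 |s_c⟩⟨s_c| - I_d`. -/
def groverCoin (d : ℕ) : WalkSpace G →L[ℂ] WalkSpace G :=
  (2 : ℂ) • ∑ u, InnerProductSpace.rankOne ℂ (coinState G d u) (coinState G d u) - 1

/-- The flip-flop shift `S`, with `S |uv⟩ = |vu⟩`. -/
def flipFlop : WalkSpace G →L[ℂ] WalkSpace G :=
  (LinearIsometryEquiv.piLpCongrLeft 2 ℂ ℂ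
    (SimpleGraph.Dart.symm_involutive (G := G)).toPerm).toContinuousLinearEquiv

/-- One step `U = S (I_N ⊗ C)` of the walk on a `d`-regular graph. -/
def walkStep (d : ℕ) : WalkSpace G →L[ℂ] WalkSpace G :=
  flipFlop G ∘L groverCoin G d

/-- The walk started in `ψ` oscillates between `ψ` and `φ` for all time with amplitude at least `c`:
it overlaps with `ψ` after every even and with `φ` after every odd number of steps. -/
def OscillatesBetween (d : ℕ) (c : ℝ) (ψ φ : WalkSpace G) : Prop :=
  ∀ t : ℕ, c ≤ ‖inner ℂ ψ ((walkStep G d ^ (2 * t)) ψ)‖ ∧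
    c ≤ ‖inner ℂ φ ((walkStep G d ^ (2 * t + 1)) ψ)‖

/-- The walk started in `ψ` stays in `ψ` for all time with amplitude at least `c`. -/
def IsStationary (d : ℕ) (c : ℝ) (ψ : WalkSpace G) : Prop :=
  ∀ t : ℕ, c ≤ ‖inner ℂ ψ ((walkStep G d ^ t) ψ)‖

end Walk

end OscLoc

end

open OscLoc

noncomputable section

namespace OscLoc

variable {V : Type u}

/-! ### Sums over darts -/

section Darts

variable [Fintype V] [DecidableEq V] (G : SimpleGraph V) [DecidableRel G.Adj]

/-! Everything reduces to a potential `p` of the unit current and its drop `R = p s - p t`, which is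
also the energy of the current.

Parallel paths: Cauchy–Schwarz on a path of length `ℓ` shows that its edges dissipate at least `R² /
ℓ`. Summing over disjoint paths gives at most the total energy `R` (`drop_le_parallelResistance`).

Connectivity: every level strictly below `p s` and at least `p t` is crossed by at least `k` edges
carrying total current 1, so at least half of `k` of them have drop at most `2 / k`. Their ends lie
close to the level, which forces `√(k/2)` vertices into a window of width `4 / k`
(`le_card_window_sq`). Disjoint windows compete for `N` vertices; when `k ≥ N^(2/3)` this bounds
their number, hence `R`. For smaller `k`, adjacency gives `R ≤ 1`, which is enough.

Walk: on amplitudes with no net outflow at any vertex the coin is `-1`, so a step is a reversal with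
a sign; if the inflows vanish too, two steps are the identity. The start state `f` is made such a
state by subtracting a current `χ` with the same outflows and inflows: a flow in `G_b` for `|ab⟩`,
in `G` for the antisymmetric state. Since `⟨f, χ⟩ = ‖χ‖² = R`, the remainder is orthogonal to `χ`
and has squared norm `1 - R`, and the part `χ` can spoil the overlap by at most `R`
(`oscillatesBetween_realState`). -/

omit [DecidableEq V] in
theorem sum_dart_eq {M : Type*} [AddCommMonoid M] (f : V → V → M) :
    ∑ d : G.Dart, f d.fst d.snd = ∑ v, ∑ w ∈ G.neighborFinset v, f v w := by
  rw [Finset.sum_sigma']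
  refine Finset.sum_bij' (fun d _ => ⟨d.fst, d.snd⟩)
    (fun x hx => ⟨(x.1, x.2), by simpa using hx⟩) ?_ ?_ ?_ ?_ ?_
  all_goals simp

omit [DecidableEq V] in
theorem sum_dart_symm {M : Type*} [AddCommMonoid M] (f : G.Dart → M) :
    ∑ d : G.Dart, f d.symm = ∑ d, f d :=
  Equiv.sum_comp (SimpleGraph.Dart.symm_involutive (G := G)).toPerm f

theorem sum_dart_edge (f : Sym2 V → ℝ) :
    ∑ d : G.Dart, f d.edge = 2 * ∑ e ∈ G.edgeFinset, f e := by
  rw [← Finset.sum_fiberwise_of_maps_to (t := G.edgeFinset) (g := fun d : G.Dart => d.edge)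
    (fun d _ => by simp), Finset.mul_sum]
  refine Finset.sum_congr rfl fun e he => ?_
  rw [Finset.sum_congr rfl (g := fun _ => f e) (fun d hd => by rw [(Finset.mem_filter.1 hd).2]),
    Finset.sum_const, G.dart_edge_fiber_card e (by simpa using he)]
  simp

end Darts

/-! ### Potentials of the unit current -/

section Potential

variable [Fintype V] [DecidableEq V] {G : SimpleGraph V} [DecidableRel G.Adj] {s t : V}
  {p : V → ℝ}

/-- Kirchhoff's law tested against `x`. Its symmetrization over the two orientations of an edge
yields the energy identity (`x = p`) and the flux through a cut (`x` an indicator). -/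
theorem IsUnitCurrentPotential.sum_mul_current (hp : IsUnitCurrentPotential G s t p) (x : V → ℝ) :
    ∑ d : G.Dart, x d.fst * (p d.fst - p d.snd) = x s - x t := by
  rw [sum_dart_eq G fun v w => x v * (p v - p w)]
  simp_rw [← Finset.mul_sum]
  rw [Finset.sum_congr rfl fun v _ => by rw [hp v]]
  simp [mul_sub, Finset.sum_sub_distrib]

theorem IsUnitCurrentPotential.sum_diff_mul_current (hp : IsUnitCurrentPotential G s t p)
    (x : V → ℝ) :
    ∑ d : G.Dart, (x d.fst - x d.snd) * (p d.fst - p d.snd) = 2 * (x s - x t) := by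
  have h := sum_dart_symm G fun d => x d.fst * (p d.fst - p d.snd)
  have e : ∀ d : G.Dart, (x d.fst - x d.snd) * (p d.fst - p d.snd) =
      x d.fst * (p d.fst - p d.snd) + x d.symm.fst * (p d.symm.fst - p d.symm.snd) := by
    intro d
    simp only [SimpleGraph.Dart.symm, Prod.fst_swap, Prod.snd_swap]
    ring
  simp_rw [e]
  rw [Finset.sum_add_distrib, h, hp.sum_mul_current]
  ring

theorem IsUnitCurrentPotential.energy (hp : IsUnitCurrentPotential G s t p) :
    ∑ d : G.Dart, (p d.fst - p d.snd) ^ 2 = 2 * (p s - p t) := by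
  rw [← hp.sum_diff_mul_current]
  simp_rw [sq]

theorem IsUnitCurrentPotential.drop_nonneg (hp : IsUnitCurrentPotential G s t p) :
    0 ≤ p s - p t := by
  have h := hp.energy
  have : 0 ≤ ∑ d : G.Dart, (p d.fst - p d.snd) ^ 2 := Finset.sum_nonneg fun _ _ => sq_nonneg _
  linarith

/-- The Laplacian as a linear map. -/
def laplacian (G : SimpleGraph V) [DecidableRel G.Adj] : (V → ℝ) →ₗ[ℝ] (V → ℝ) where
  toFun p v := ∑ w ∈ G.neighborFinset v, (p v - p w)
  map_add' p q := by
    ext v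
    simp only [Pi.add_apply, ← Finset.sum_add_distrib]
    exact Finset.sum_congr rfl fun _ _ => by ring
  map_smul' c p := by
    ext v
    simp only [Pi.smul_apply, smul_eq_mul, RingHom.id_apply, Finset.mul_sum]
    exact Finset.sum_congr rfl fun _ _ => by ring

omit [DecidableEq V] in
theorem sum_mul_laplacian (x : V → ℝ) :
    2 * ∑ v, x v * laplacian G x v = ∑ d : G.Dart, (x d.fst - x d.snd) ^ 2 := by
  have h := sum_dart_symm G fun d => x d.fst * (x d.fst - x d.snd)
  have e : ∀ d : G.Dart, (x d.fst - x d.snd) ^ 2 =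
      x d.fst * (x d.fst - x d.snd) + x d.symm.fst * (x d.symm.fst - x d.symm.snd) := by
    intro d
    simp only [SimpleGraph.Dart.symm, Prod.fst_swap, Prod.snd_swap]
    ring
  simp_rw [e]
  rw [Finset.sum_add_distrib, h, ← two_mul, sum_dart_eq G fun v w => x v * (x v - x w)]
  simp_rw [← Finset.mul_sum]
  rfl

/-- Fredholm alternative: if the source vector were outside the range of the Laplacian, some
functional `c` would kill the range but not the source. Pairing `c` with its own Laplacian makes its
Dirichlet energy vanish, so `c` is constant along edges, `c s = c t`, and it kills the source after
all. -/
theorem exists_isUnitCurrentPotential (h : G.Reachable s t) :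
    ∃ p, IsUnitCurrentPotential G s t p := by
  set b : V → ℝ := fun v => (if v = s then (1 : ℝ) else 0) - (if v = t then (1 : ℝ) else 0)
    with hb
  suffices hr : b ∈ LinearMap.range (laplacian G) by
    obtain ⟨p, hp⟩ := hr
    exact ⟨p, fun v => congrFun hp v⟩
  by_contra hr
  obtain ⟨f, hf, hle⟩ := Submodule.exists_le_ker_of_notMem hr
  set c : V → ℝ := fun v => f (Pi.single v 1) with hc
  have hfc : ∀ y : V → ℝ, f y = ∑ v, c v * y v := by
    intro y
    rw [LinearMap.pi_apply_eq_sum_univ f y]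
    refine Finset.sum_congr rfl fun v _ => ?_
    rw [smul_eq_mul, mul_comm, hc]
    congr 2
    ext w
    simp [Pi.single_apply, eq_comm]
  have h0 : ∑ d : G.Dart, (c d.fst - c d.snd) ^ 2 = 0 := by
    rw [← sum_mul_laplacian, ← hfc, LinearMap.mem_ker.1 (hle ⟨c, rfl⟩), mul_zero]
  rw [Finset.sum_eq_zero_iff_of_nonneg fun _ _ => sq_nonneg _] at h0
  have hadj : ∀ u v, G.Adj u v → c u = c v := fun u v huv => by
    have := h0 ⟨(u, v), huv⟩ (Finset.mem_univ _)
    exact sub_eq_zero.1 (pow_eq_zero_iff two_ne_zero |>.1 this)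
  have hst : c s = c t := by
    obtain ⟨w⟩ := h
    clear hf hr hb b
    induction w with
    | nil => rfl
    | cons h _ ih => exact (hadj _ _ h).trans ih
  apply hf
  rw [hfc]
  simp [hb, mul_sub, Finset.sum_sub_distrib, hst]

/-! ### Parallel paths -/

/-- The absolute potential drop along an edge. -/
def edgeDrop (p : V → ℝ) : Sym2 V → ℝ :=
  Sym2.lift ⟨fun u v => |p u - p v|, fun _ _ => abs_sub_comm _ _⟩

omit [Fintype V] [DecidableEq V] [DecidableRel G.Adj] in
theorem abs_drop_le_sum_edgeDrop (p : V → ℝ) {u v : V} (w : G.Walk u v) :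
    |p u - p v| ≤ (w.edges.map (edgeDrop p)).sum := by
  induction w with
  | nil => simp
  | @cons a b c h w ih =>
    simp only [SimpleGraph.Walk.edges_cons, List.map_cons, List.sum_cons]
    have : edgeDrop p s(a, b) = |p a - p b| := rfl
    rw [this]
    exact (abs_sub_le _ (p b) _).trans (by gcongr)

theorem IsUnitCurrentPotential.sum_edgeDrop_sq (hp : IsUnitCurrentPotential G s t p) :
    ∑ e ∈ G.edgeFinset, edgeDrop p e ^ 2 = p s - p t := by
  have h := sum_dart_edge G fun e => edgeDrop p e ^ 2
  have e : ∀ d : G.Dart, edgeDrop p d.edge ^ 2 = (p d.fst - p d.snd) ^ 2 := fun d => sq_abs _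
  simp_rw [e] at h
  rw [hp.energy] at h
  linarith

/-- The edge `st` alone dissipates `R²`, out of a total energy `R`. -/
theorem IsUnitCurrentPotential.drop_le_one_of_adj (hp : IsUnitCurrentPotential G s t p)
    (h : G.Adj s t) : p s - p t ≤ 1 := by
  have h1 := Finset.single_le_sum (f := fun e => edgeDrop p e ^ 2) (fun _ _ => sq_nonneg _)
    (show s(s, t) ∈ G.edgeFinset by simpa using h)
  rw [hp.sum_edgeDrop_sq] at h1
  have h2 : edgeDrop p s(s, t) ^ 2 = (p s - p t) ^ 2 := sq_abs _
  simp only [h2] at h1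
  nlinarith

theorem IsUnitCurrentPotential.drop_le_parallelResistance (hp : IsUnitCurrentPotential G s t p)
    (hst : s ≠ t) {k : ℕ} (hk : 0 < k) (P : Fin k → G.Path s t) (hP : EdgeDisjoint P) :
    p s - p t ≤ parallelResistance P := by
  set R := p s - p t with hR
  have hlen : ∀ i, 0 < ((P i).1.length : ℝ) := fun i => by
    rw [Nat.cast_pos, Nat.pos_iff_ne_zero]
    exact fun h => hst (SimpleGraph.Walk.eq_of_length_eq_zero h)
  set F : Fin k → Finset (Sym2 V) := fun i => (P i).1.edges.toFinset with hF
  have hcs : ∀ i, R ^ 2 * (1 / ((P i).1.length : ℝ)) ≤ ∑ e ∈ F i, edgeDrop p e ^ 2 := by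
    intro i
    have hnd := (P i).2.isTrail.edges_nodup
    have h1 : |R| ≤ ∑ e ∈ F i, edgeDrop p e := by
      rw [hF, List.sum_toFinset _ hnd]
      exact abs_drop_le_sum_edgeDrop p _
    have h2 : R ^ 2 ≤ (∑ e ∈ F i, edgeDrop p e) ^ 2 := by
      rw [← sq_abs]
      gcongr
    have h3 := h2.trans sq_sum_le_card_mul_sum_sq
    rw [hF, List.toFinset_card_of_nodup hnd, SimpleGraph.Walk.length_edges] at h3
    rw [mul_one_div, div_le_iff₀ (hlen i), mul_comm]
    exact h3
  have hdisj : Set.PairwiseDisjoint (↑(Finset.univ : Finset (Fin k))) F := by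
    intro i _ j _ hij
    simpa [F, Function.onFun, List.disjoint_toFinset_iff_disjoint] using hP i j hij
  have hsum : R ^ 2 * ∑ i, 1 / ((P i).1.length : ℝ) ≤ R := by
    rw [Finset.mul_sum]
    refine (Finset.sum_le_sum fun i _ => hcs i).trans ?_
    rw [← Finset.sum_biUnion hdisj, hR, ← hp.sum_edgeDrop_sq]
    refine Finset.sum_le_sum_of_subset_of_nonneg ?_ fun _ _ _ => sq_nonneg _
    intro e he
    obtain ⟨i, _, hi⟩ := Finset.mem_biUnion.1 he
    simpa using (P i).1.edges_subset_edgeSet (List.mem_toFinset.1 hi)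
  have hpos : 0 < ∑ i, 1 / ((P i).1.length : ℝ) :=
    Finset.sum_pos (fun i _ => one_div_pos.2 (hlen i)) ⟨⟨0, hk⟩, Finset.mem_univ _⟩
  rw [parallelResistance, le_div_iff₀ hpos]
  -- `hsum` is quadratic in `R`; dividing by `R` needs `R > 0`.
  rcases hp.drop_nonneg.eq_or_lt with h | h
  · rw [← hR] at h
    rw [← h]
    simp
  · rw [← hR] at h
    rw [sq, mul_assoc] at hsum
    exact le_of_mul_le_mul_left (by linarith) h

/-! ### Level cuts -/

/-- The darts along which the potential crosses the level `c` downwards. -/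
def levelCut (G : SimpleGraph V) [DecidableRel G.Adj] (p : V → ℝ) (c : ℝ) : Finset G.Dart :=
  {d | c < p d.fst ∧ p d.snd ≤ c}

omit [DecidableEq V] in
theorem mem_levelCut {c : ℝ} {d : G.Dart} : d ∈ levelCut G p c ↔ c < p d.fst ∧ p d.snd ≤ c := by
  simp [levelCut]

/-- Test the current against the indicator of the superlevel set: only crossing edges survive, once
for each orientation. -/
theorem IsUnitCurrentPotential.sum_levelCut (hp : IsUnitCurrentPotential G s t p) {c : ℝ}
    (hs : c < p s) (ht : p t ≤ c) : ∑ d ∈ levelCut G p c, (p d.fst - p d.snd) = 1 := by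
  have h := hp.sum_diff_mul_current fun v => if c < p v then 1 else 0
  have h' := sum_dart_symm G fun d =>
    if c < p d.fst ∧ p d.snd ≤ c then p d.fst - p d.snd else 0
  have e : ∀ d : G.Dart, ((if c < p d.fst then (1 : ℝ) else 0) - if c < p d.snd then 1 else 0) *
      (p d.fst - p d.snd) = (if c < p d.fst ∧ p d.snd ≤ c then p d.fst - p d.snd else 0) +
        if c < p d.symm.fst ∧ p d.symm.snd ≤ c then p d.symm.fst - p d.symm.snd else 0 := by
    intro d
    simp only [SimpleGraph.Dart.symm, Prod.fst_swap, Prod.snd_swap, ← not_lt]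
    by_cases h1 : c < p d.fst <;> by_cases h2 : c < p d.snd <;> simp [h1, h2]
  simp_rw [e] at h
  rw [Finset.sum_add_distrib, h', if_pos hs, if_neg (not_lt.2 ht)] at h
  rw [levelCut, Finset.sum_filter]
  linarith

omit [DecidableEq V] in
-- Each path must leave the superlevel set, and disjointness makes the chosen exit darts distinct.
theorem le_card_levelCut {k : ℕ} (P : Fin k → G.Path s t) (hP : EdgeDisjoint P) {c : ℝ}
    (hs : c < p s) (ht : p t ≤ c) : k ≤ (levelCut G p c).card := by
  have h : ∀ i, ∃ d : G.Dart, d ∈ (P i).1.darts ∧ c < p d.fst ∧ p d.snd ≤ c := fun i => by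
    obtain ⟨d, hd, h1, h2⟩ := (P i).1.exists_boundary_dart {v | c < p v} hs (by simpa using ht)
    exact ⟨d, hd, h1, by simpa using h2⟩
  choose f hf hf' using h
  have hinj : Function.Injective f := by
    intro i j hij
    by_contra hne
    refine hP i j hne (a := (f i).edge) (List.mem_map_of_mem (hf i)) ?_
    rw [hij]
    exact List.mem_map_of_mem (hf j)
  simpa using Finset.card_le_card_of_injOn f (s := Finset.univ)
    (fun i _ => mem_levelCut.2 (hf' i)) hinj.injOn

/-- Around every level there are at least `√(k/2)` vertices. -/
theorem IsUnitCurrentPotential.le_card_window_sq (hp : IsUnitCurrentPotential G s t p)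
    {k : ℕ} (hk : 0 < k) (P : Fin k → G.Path s t) (hP : EdgeDisjoint P) {c : ℝ}
    (hs : c < p s) (ht : p t ≤ c) :
    (k : ℝ) / 2 ≤ ((Finset.univ.filter fun v => c - 2 / k < p v ∧ p v ≤ c + 2 / k).card : ℝ) ^ 2 := by
  set W := Finset.univ.filter fun v => c - 2 / k < p v ∧ p v ≤ c + 2 / k with hW
  have hk' : (0 : ℝ) < k := Nat.cast_pos.2 hk
  have hcard : (k : ℝ) ≤ (levelCut G p c).card := Nat.cast_le.2 (le_card_levelCut P hP hs ht)
  have hsplit := Finset.card_filter_add_card_filter_not (s := levelCut G p c)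
    (fun d => p d.fst - p d.snd ≤ 2 / k)
  set A := (levelCut G p c).filter fun d => p d.fst - p d.snd ≤ 2 / k with hA
  set B := (levelCut G p c).filter fun d => ¬ p d.fst - p d.snd ≤ 2 / k with hB
  -- Darts in `B` each carry more than `2 / k`, out of a total current 1.
  have hBcard : (B.card : ℝ) ≤ k / 2 := by
    have h1 : B.card • (2 / k : ℝ) ≤ ∑ d ∈ B, (p d.fst - p d.snd) :=
      Finset.card_nsmul_le_sum _ _ _ fun d hd => (not_le.1 (Finset.mem_filter.1 hd).2).le
    have h2 : ∑ d ∈ B, (p d.fst - p d.snd) ≤ 1 := by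
      rw [← hp.sum_levelCut hs ht]
      refine Finset.sum_le_sum_of_subset_of_nonneg (Finset.filter_subset _ _) fun d hd _ => ?_
      have := mem_levelCut.1 hd
      linarith
    have h3 := h1.trans h2
    rw [nsmul_eq_mul, mul_div_assoc', div_le_one hk'] at h3
    linarith
  -- Both ends of a short crossing dart lie in the window, and in a simple graph the ordered pair of
  -- ends determines the dart. This is where the square root comes from.
  have hAcard : A.card ≤ W.card ^ 2 := by
    rw [sq, ← Finset.card_product]
    refine Finset.card_le_card_of_injOn (fun d => d.toProd) ?_
      (SimpleGraph.Dart.toProd_injective.injOn)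
    intro d hd
    obtain ⟨h1, h2⟩ := Finset.mem_filter.1 hd
    obtain ⟨h3, h4⟩ := mem_levelCut.1 h1
    have h5 : (0 : ℝ) < 2 / k := by positivity
    simp only [Finset.coe_product, Set.mem_prod, Finset.mem_coe, hW, Finset.mem_filter,
      Finset.mem_univ, true_and]
    refine ⟨⟨?_, ?_⟩, ?_, ?_⟩ <;> linarith
  have hA' : (A.card : ℝ) ≤ (W.card : ℝ) ^ 2 := by exact_mod_cast hAcard
  have hs' : (A.card : ℝ) + B.card = (levelCut G p c).card := by exact_mod_cast hsplit
  linarith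

theorem IsUnitCurrentPotential.drop_le_of_edgeConnectedPair
    (hp : IsUnitCurrentPotential G s t p) {k : ℕ} (hk : 0 < k) (h : EdgeConnectedPair G s t k)
    (hN : (Fintype.card V : ℝ) ^ (2 / 3 : ℝ) ≤ k) :
    p s - p t ≤ 12 * (Fintype.card V : ℝ) ^ (2 / 3 : ℝ) / k := by
  obtain ⟨P, hP⟩ := h
  have hk' : (0 : ℝ) < k := Nat.cast_pos.2 hk
  have hN1 : (1 : ℝ) ≤ Fintype.card V := by
    exact_mod_cast Fintype.card_pos_iff.2 ⟨s⟩
  set T : ℝ := (Fintype.card V : ℝ) ^ (1 / 3 : ℝ) with hT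
  have hT1 : 1 ≤ T := Real.one_le_rpow hN1 (by norm_num)
  have hT2 : (Fintype.card V : ℝ) ^ (2 / 3 : ℝ) = T ^ 2 := by
    rw [hT, ← Real.rpow_natCast, ← Real.rpow_mul (by positivity)]
    norm_num
  have hT3 : (Fintype.card V : ℝ) = T ^ 3 := by
    rw [hT, ← Real.rpow_natCast, ← Real.rpow_mul (by positivity)]
    norm_num
  rw [hT2] at hN ⊢
  -- The number of consecutive half-open windows of width `4 / k` that fit between `p t` and `p s`;
  -- they are centred at odd multiples of `2 / k` above `p t`.
  set m := ⌊(p s - p t) / (4 / k)⌋₊ with hm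
  have h4k : (0 : ℝ) < 4 / k := by positivity
  set W : ℕ → Finset V := fun j => Finset.univ.filter fun v =>
    (p t + (2 * j + 1) * (2 / k)) - 2 / k < p v ∧ p v ≤ (p t + (2 * j + 1) * (2 / k)) + 2 / k
    with hW
  have hWcard : ∀ j ∈ Finset.range m, T / 2 ≤ ((W j).card : ℝ) := by
    intro j hj
    have hjm : (j : ℝ) + 1 ≤ m := by exact_mod_cast Finset.mem_range.1 hj
    have hmle : (m : ℝ) ≤ (p s - p t) / (4 / k) :=
      Nat.floor_le (div_nonneg hp.drop_nonneg h4k.le)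
    rw [le_div_iff₀ h4k] at hmle
    have hjm' : ((j : ℝ) + 1) * (4 / k) ≤ p s - p t :=
      (mul_le_mul_of_nonneg_right hjm h4k.le).trans hmle
    have h2k : (4 : ℝ) / k = 2 * (2 / k) := by ring
    have h2k' : (0 : ℝ) < 2 / k := by positivity
    have hsq := hp.le_card_window_sq hk P hP (c := p t + (2 * j + 1) * (2 / k))
      (by rw [h2k] at hjm'; linarith) (by have : (0 : ℝ) ≤ (2 * j + 1) * (2 / k) := by positivity
                                          linarith)
    refine le_of_sq_le_sq ?_ (Nat.cast_nonneg _)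
    -- From `T² ≤ k` follows `(T / 2)² ≤ k / 2`.
    nlinarith
  have hdisj : Set.PairwiseDisjoint (↑(Finset.range m)) W := by
    have key : ∀ i j : ℕ, i < j → ∀ v, v ∈ W i → v ∉ W j := by
      intro i j hij v hi hj
      have h1 := (Finset.mem_filter.1 hi).2.2
      have h2 := (Finset.mem_filter.1 hj).2.1
      have h3 : (i : ℝ) + 1 ≤ j := by exact_mod_cast hij
      have h2k' : (0 : ℝ) < 2 / k := by positivity
      nlinarith
    intro i _ j _ hij
    refine Finset.disjoint_left.2 fun v hi hj => ?_
    rcases lt_or_gt_of_ne hij with h | h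
    · exact key i j h v hi hj
    · exact key j i h v hj hi
  have hcount : (m : ℝ) * (T / 2) ≤ T ^ 3 := by
    have h1 : ((Finset.range m).biUnion W).card ≤ Fintype.card V := Finset.card_le_univ _
    rw [Finset.card_biUnion hdisj] at h1
    have h2 := Finset.card_nsmul_le_sum _ _ _ hWcard
    rw [Finset.card_range, nsmul_eq_mul] at h2
    rw [← hT3]
    refine h2.trans ?_
    exact_mod_cast h1
  have hm2 : (m : ℝ) ≤ 2 * T ^ 2 := by
    have : (0 : ℝ) < T / 2 := by linarith
    refine le_of_mul_le_mul_right ?_ this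
    linarith
  have hlt := Nat.lt_floor_add_one ((p s - p t) / (4 / k))
  rw [← hm, div_lt_iff₀ h4k] at hlt
  refine hlt.le.trans ?_
  rw [mul_div_assoc', div_le_div_iff_of_pos_right hk']
  -- The drop is below `(m + 1) * 4 / k` with `m ≤ 2 T²`, and `1 ≤ T²` absorbs the rounding: `4 * (2
  -- + 1) = 12`.
  nlinarith

theorem IsUnitCurrentPotential.drop_le_of_edgeConnectedPair_of_adj_or
    (hp : IsUnitCurrentPotential G s t p) {k : ℕ} (hk : 0 < k) (h : EdgeConnectedPair G s t k)
    (h' : G.Adj s t ∨ (Fintype.card V : ℝ) ^ (2 / 3 : ℝ) ≤ k) :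
    p s - p t ≤ 12 * (Fintype.card V : ℝ) ^ (2 / 3 : ℝ) / k := by
  by_cases hN : (Fintype.card V : ℝ) ^ (2 / 3 : ℝ) ≤ k
  · exact hp.drop_le_of_edgeConnectedPair hk h hN
  · refine (hp.drop_le_one_of_adj (h'.resolve_right hN)).trans ?_
    rw [one_le_div (Nat.cast_pos.2 hk)]
    push Not at hN
    linarith [Nat.cast_nonneg (α := ℝ) k]

end Potential

end OscLoc

end

noncomputable section

namespace OscLoc

variable {V : Type u}

/-! ### Isometries with an invariant component -/

theorem inner_pow_of_inner_map {E : Type*} [NormedAddCommGroup E] [InnerProductSpace ℂ E]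
    {U : E →L[ℂ] E} (hU : ∀ x y, inner ℂ (U x) (U y) = inner ℂ x y) (n : ℕ) (x y : E) :
    inner ℂ ((U ^ n) x) ((U ^ n) y) = inner ℂ x y := by
  induction n with
  | zero => simp
  | succ n ih => rw [pow_succ', mul_apply_eq_comp, mul_apply_eq_comp, hU, ih]

/-- The cross terms vanish because an isometry preserves `φ ⟂ χ`. The `φ` part contributes exactly
`‖φ‖²`, and Cauchy–Schwarz limits the uncontrolled `χ` part to `‖χ‖²`. -/
theorem le_norm_inner_pow_of_orthogonal {E : Type*} [NormedAddCommGroup E] [InnerProductSpace ℂ E]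
    {U : E →L[ℂ] E} (hU : ∀ x y, inner ℂ (U x) (U y) = inner ℂ x y) {n : ℕ} {φ χ φ' χ' : E}
    (hφ : (U ^ n) φ = φ') (h : inner ℂ φ χ = 0) (h' : inner ℂ φ' χ' = 0) (hχ : ‖χ'‖ = ‖χ‖) :
    ‖φ‖ ^ 2 - ‖χ‖ ^ 2 ≤ ‖inner ℂ (φ' + χ') ((U ^ n) (φ + χ))‖ := by
  have h1 : inner ℂ φ' ((U ^ n) χ) = 0 := by rw [← hφ, inner_pow_of_inner_map hU, h]
  have h2 : inner ℂ φ' φ' = inner ℂ φ φ := by rw [← hφ, inner_pow_of_inner_map hU]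
  have h3 : ‖(U ^ n) χ‖ = ‖χ‖ := by
    rw [@norm_eq_sqrt_re_inner ℂ, @norm_eq_sqrt_re_inner ℂ _ _ _ _ χ, inner_pow_of_inner_map hU]
  rw [map_add, hφ, inner_add_left, inner_add_right, inner_add_right, h1, h2,
    inner_eq_zero_symm.1 h', add_zero, zero_add, inner_self_eq_norm_sq_to_K]
  have h4 : ‖inner ℂ χ' ((U ^ n) χ)‖ ≤ ‖χ‖ ^ 2 := by
    refine (norm_inner_le_norm _ _).trans_eq ?_
    rw [h3, hχ, sq]
  have h5 := norm_sub_le_norm_add ((‖φ‖ : ℂ) ^ 2) (inner ℂ χ' ((U ^ n) χ))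
  have h6 : ‖((‖φ‖ : ℂ) ^ 2)‖ = ‖φ‖ ^ 2 := by simp
  rw [h6] at h5
  exact (sub_le_sub_left h4 _).trans h5

/-! ### The walk operator -/

section Walk

variable [Fintype V] [DecidableEq V] (G : SimpleGraph V) [DecidableRel G.Adj]

omit [DecidableEq V] in
theorem flipFlop_apply (x : WalkSpace G) (e : G.Dart) : flipFlop G x e = x e.symm := by
  rfl

omit [DecidableEq V] in
theorem inner_flipFlop (x y : WalkSpace G) :
    inner ℂ (flipFlop G x) (flipFlop G y) = inner ℂ x y :=
  LinearIsometryEquiv.inner_map_map _ _ _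

theorem inner_coinState (d : ℕ) (u : V) (x : WalkSpace G) :
    inner ℂ (coinState G d u) x =
      ((1 / Real.sqrt d : ℝ) : ℂ) * ∑ e : G.Dart, if e.fst = u then x e else 0 := by
  rw [PiLp.inner_apply, Finset.mul_sum]
  refine Finset.sum_congr rfl fun e _ => ?_
  simp only [coinState]
  split_ifs <;> simp [mul_comm]

variable {G} in
theorem orthonormal_coinState {d : ℕ} (hd : 0 < d) (hG : G.IsRegularOfDegree d) :
    Orthonormal ℂ (coinState G d) := by
  rw [orthonormal_iff_ite]
  intro u v
  rw [inner_coinState]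
  have e : ∀ e : G.Dart, (if e.fst = u then coinState G d v e else 0) =
      if e.fst = u then (if u = v then ((1 / Real.sqrt d : ℝ) : ℂ) else 0) else 0 := by
    intro e
    simp only [coinState]
    by_cases h : e.fst = u <;> simp [h]
  simp_rw [e]
  rw [← Finset.sum_filter, Finset.sum_const, G.dart_fst_fiber_card_eq_degree, hG u]
  split_ifs
  · rw [nsmul_eq_mul]
    have h1 : Real.sqrt d ≠ 0 := (Real.sqrt_pos.2 (Nat.cast_pos.2 hd)).ne'
    have h2 : (1 / Real.sqrt d) * (d * (1 / Real.sqrt d)) = 1 := by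
      field_simp
      exact (Real.sq_sqrt (Nat.cast_nonneg d)).symm
    exact_mod_cast h2
  · simp

theorem groverCoin_apply (d : ℕ) (x : WalkSpace G) :
    groverCoin G d x =
      (2 : ℂ) • ∑ u, inner ℂ (coinState G d u) x • coinState G d u - x := by
  simp [groverCoin]

variable {G} in
-- The coin is a reflection `2P - 1`; orthonormality of the coin states makes `P` an orthogonal
-- projection.
theorem inner_groverCoin {d : ℕ} (hd : 0 < d) (hG : G.IsRegularOfDegree d) (x y : WalkSpace G) :
    inner ℂ (groverCoin G d x) (groverCoin G d y) = inner ℂ x y := by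
  have ho := orthonormal_coinState hd hG
  have h1 := ho.inner_sum (fun u => inner ℂ (coinState G d u) x)
    (fun u => inner ℂ (coinState G d u) y) Finset.univ
  have h2 : inner ℂ (∑ u, inner ℂ (coinState G d u) x • coinState G d u) y =
      ∑ u, (starRingEnd ℂ) (inner ℂ (coinState G d u) x) * inner ℂ (coinState G d u) y := by
    simp_rw [sum_inner, inner_smul_left]
  have h3 : inner ℂ x (∑ u, inner ℂ (coinState G d u) y • coinState G d u) =
      ∑ u, (starRingEnd ℂ) (inner ℂ (coinState G d u) x) * inner ℂ (coinState G d u) y := by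
    simp_rw [inner_sum, inner_smul_right, inner_conj_symm]
    exact Finset.sum_congr rfl fun _ _ => mul_comm _ _
  rw [groverCoin_apply, groverCoin_apply, inner_sub_left, inner_sub_right, inner_sub_right,
    inner_smul_left, inner_smul_left, inner_smul_right, inner_smul_right, h1, h2, h3]
  simp only [map_ofNat]
  ring

variable {G} in
theorem inner_walkStep {d : ℕ} (hd : 0 < d) (hG : G.IsRegularOfDegree d) (x y : WalkSpace G) :
    inner ℂ (walkStep G d x) (walkStep G d y) = inner ℂ x y := by
  rw [walkStep, ContinuousLinearMap.comp_apply, ContinuousLinearMap.comp_apply, inner_flipFlop,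
    inner_groverCoin hd hG]

/-! ### States with real amplitudes -/

variable {G}

/-- The state with the real amplitudes `f`. -/
def realState (f : G.Dart → ℝ) : WalkSpace G :=
  WithLp.toLp 2 fun e => (f e : ℂ)

/-- The total amplitude of the darts that leave `u`. -/
def outflow (f : G.Dart → ℝ) (u : V) : ℝ :=
  ∑ e : G.Dart, if e.fst = u then f e else 0

theorem outflow_sub (f g : G.Dart → ℝ) (u : V) :
    outflow (fun e => f e - g e) u = outflow f u - outflow g u := by
  rw [outflow, outflow, outflow, ← Finset.sum_sub_distrib]
  exact Finset.sum_congr rfl fun e _ => by split_ifs <;> simp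

theorem outflow_neg (f : G.Dart → ℝ) (u : V) : outflow (fun e => -f e) u = -outflow f u := by
  rw [outflow, outflow, ← Finset.sum_neg_distrib]
  exact Finset.sum_congr rfl fun e _ => by split_ifs <;> simp

theorem outflow_smul (c : ℝ) (f : G.Dart → ℝ) (u : V) :
    outflow (fun e => c * f e) u = c * outflow f u := by
  rw [outflow, outflow, Finset.mul_sum]
  exact Finset.sum_congr rfl fun e _ => by split_ifs <;> simp

theorem outflow_eq (F : V → V → ℝ) (u : V) :
    outflow (fun e : G.Dart => F e.fst e.snd) u = ∑ w ∈ G.neighborFinset u, F u w := by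
  rw [outflow, sum_dart_eq G fun v w => if v = u then F v w else 0, Finset.sum_eq_single u]
  · simp
  · intro v _ hv
    simp [hv]
  · simp

theorem outflow_single (a : G.Dart) (u : V) :
    outflow (fun e => if e = a then (1 : ℝ) else 0) u = if u = a.fst then 1 else 0 := by
  rw [outflow, Finset.sum_eq_single a]
  · simp [eq_comm]
  · intro b _ hb
    simp [hb]
  · simp

omit [DecidableEq V] in
theorem inner_realState (f g : G.Dart → ℝ) :
    inner ℂ (realState f) (realState g) = ((∑ e, f e * g e : ℝ) : ℂ) := by
  rw [PiLp.inner_apply]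
  simp [realState, mul_comm]

omit [DecidableEq V] in
theorem norm_sq_realState (f : G.Dart → ℝ) : ‖realState f‖ ^ 2 = ∑ e, f e ^ 2 := by
  simp [EuclideanSpace.norm_sq_eq, realState]

omit [DecidableEq V] in
theorem norm_realState_neg_symm (f : G.Dart → ℝ) :
    ‖realState fun e => -f e.symm‖ = ‖realState f‖ := by
  rw [← sq_eq_sq₀ (norm_nonneg _) (norm_nonneg _), norm_sq_realState, norm_sq_realState,
    ← sum_dart_symm G fun e => f e ^ 2]
  simp

omit [Fintype V] [DecidableEq V] [DecidableRel G.Adj] in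
theorem realState_add (f g : G.Dart → ℝ) :
    realState f + realState g = realState fun e => f e + g e := by
  ext e
  simp [realState]

/-- The overlap with the coin state at `u` is a multiple of the outflow at `u`, so here the
projection in the coin vanishes. -/
theorem walkStep_realState (d : ℕ) {f : G.Dart → ℝ} (hf : ∀ u, outflow f u = 0) :
    walkStep G d (realState f) = realState fun e => -f e.symm := by
  have h : groverCoin G d (realState f) = -realState f := by
    rw [groverCoin_apply, Finset.sum_eq_zero, smul_zero, zero_sub]
    intro u _
    have h0 : (∑ e : G.Dart, if e.fst = u then realState f e else 0) = 0 := by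
      have h1 : ((outflow f u : ℝ) : ℂ) = 0 := by rw [hf u, Complex.ofReal_zero]
      refine Eq.trans ?_ h1
      rw [outflow, Complex.ofReal_sum]
      exact Finset.sum_congr rfl fun e _ => by
        by_cases he : e.fst = u <;> simp [realState, he]
    rw [inner_coinState, h0, mul_zero, zero_smul]
  rw [walkStep, ContinuousLinearMap.comp_apply, h]
  ext e
  rw [flipFlop_apply]
  simp [realState]

/-- If `f - χ` has zero total amplitude on the darts leaving and on the darts entering every vertex,
and `χ` is orthogonal to it, then the walk started in `f` oscillates. -/
theorem oscillatesBetween_realState {d : ℕ} (hd : 0 < d) (hG : G.IsRegularOfDegree d)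
    {f χ : G.Dart → ℝ} (hout : ∀ u, outflow f u = outflow χ u)
    (hin : ∀ u, outflow (fun e => f e.symm) u = outflow (fun e => χ e.symm) u)
    (horth : ∑ e, f e * χ e = ∑ e, χ e ^ 2) :
    OscillatesBetween G d (∑ e, f e ^ 2 - 2 * ∑ e, χ e ^ 2) (realState f)
      (realState fun e => -f e.symm) := by
  set g : G.Dart → ℝ := fun e => f e - χ e with hg
  have hf : realState f = realState g + realState χ := by
    rw [realState_add]
    simp [hg]
  have hf' : (realState fun e => -f e.symm) =
      (realState fun e => -g e.symm) + realState fun e => -χ e.symm := by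
    rw [realState_add]
    congr 1
    ext e
    simp only [hg]
    ring
  have hgout : ∀ u, outflow g u = 0 := fun u => by rw [hg, outflow_sub, hout, sub_self]
  have hgin : ∀ u, outflow (fun e => -g e.symm) u = 0 := fun u => by
    rw [outflow_neg, hg, outflow_sub (fun e => f e.symm) fun e => χ e.symm, hin, sub_self, neg_zero]
  have hstep := walkStep_realState d hgout
  have hstep' := walkStep_realState d hgin
  simp only [SimpleGraph.Dart.symm_symm, neg_neg] at hstep'
  -- Reversal with a sign, applied twice, is the identity. The second step needs zero outflow of the
  -- reversed state, that is, zero inflow of `g`.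
  have heven : ∀ t : ℕ, (walkStep G d ^ (2 * t)) (realState g) = realState g := by
    intro t
    induction t with
    | zero => simp
    | succ t ih =>
      rw [mul_add, mul_one, pow_add, mul_apply_eq_comp, sq,
        mul_apply_eq_comp, hstep, hstep', ih]
  have hodd : ∀ t : ℕ, (walkStep G d ^ (2 * t + 1)) (realState g) =
      realState fun e => -g e.symm := by
    intro t
    rw [pow_succ', mul_apply_eq_comp, heven, hstep]
  have hgχ : ∑ e, g e * χ e = 0 := by
    simp only [hg, sub_mul, Finset.sum_sub_distrib, horth, ← sq, sub_self]
  have h0 : inner ℂ (realState g) (realState χ) = 0 := by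
    rw [inner_realState, hgχ, Complex.ofReal_zero]
  have h0' : inner ℂ (realState fun e => -g e.symm) (realState fun e => -χ e.symm) = 0 := by
    rw [inner_realState]
    simp only [neg_mul_neg]
    rw [sum_dart_symm G fun e => g e * χ e, hgχ, Complex.ofReal_zero]
  have hc : ∑ e, f e ^ 2 - 2 * ∑ e, χ e ^ 2 = ‖realState g‖ ^ 2 - ‖realState χ‖ ^ 2 := by
    rw [norm_sq_realState, norm_sq_realState]
    have : ∀ e, g e ^ 2 = f e ^ 2 - 2 * (f e * χ e) + χ e ^ 2 := fun e => by
      simp only [hg]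
      ring
    simp_rw [this]
    rw [Finset.sum_add_distrib, Finset.sum_sub_distrib, ← Finset.mul_sum, horth]
    ring
  have hU := inner_walkStep hd hG
  intro t
  rw [hc, hf', hf]
  exact ⟨le_norm_inner_pow_of_orthogonal hU (heven t) h0 h0 rfl,
    le_norm_inner_pow_of_orthogonal hU (hodd t) h0 h0' (norm_realState_neg_symm χ)⟩

theorem OscillatesBetween.mono {d : ℕ} {c c' : ℝ} {ψ φ : WalkSpace G}
    (h : OscillatesBetween G d c ψ φ) (hc : c' ≤ c) : OscillatesBetween G d c' ψ φ :=
  fun t => ⟨hc.trans (h t).1, hc.trans (h t).2⟩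

theorem OscillatesBetween.isStationary {d : ℕ} {c : ℝ} {ψ : WalkSpace G}
    (h : OscillatesBetween G d c ψ ψ) : IsStationary G d c ψ := by
  intro t
  obtain ⟨k, rfl | rfl⟩ := Nat.even_or_odd' t
  exacts [(h k).1, (h k).2]

omit [Fintype V] [DecidableRel G.Adj] in
theorem ket_eq_realState {a b : V} (h : G.Adj a b) :
    ket h = realState fun e => if e = (⟨(a, b), h⟩ : G.Dart) then (1 : ℝ) else 0 := by
  ext e
  by_cases he : e = (⟨(a, b), h⟩ : G.Dart) <;> simp [ket, realState, he]

omit [DecidableEq V] in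
theorem degree_pos_of_adj_of_regular {d : ℕ} (hG : G.IsRegularOfDegree d) {a b : V}
    (h : G.Adj a b) : 0 < d := by
  rw [← hG a]
  exact (G.degree_pos_iff_exists_adj a).2 ⟨b, h⟩

/-! ### Localization -/

/-- Subtract the unit current in `G`, scaled like the start state. Both are antisymmetric under
reversal, so matching outflows also match inflows, and the oscillation partner is the start state
itself. -/
theorem isStationary_of_potential {d : ℕ} (hG : G.IsRegularOfDegree d) {a b : V}
    (hab : G.Adj a b) {p : V → ℝ} (hp : IsUnitCurrentPotential G a b p) :
    IsStationary G d (1 - 2 * (p a - p b))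
      ((1 / (Real.sqrt 2 : ℂ)) • (ket hab - ket hab.symm)) := by
  set α : G.Dart := ⟨(a, b), hab⟩ with hα
  have hne : α ≠ α.symm := α.symm_ne.symm
  set r : ℝ := 1 / Real.sqrt 2 with hr
  have hr2 : r ^ 2 = 1 / 2 := by
    rw [hr, div_pow, one_pow, Real.sq_sqrt (by norm_num)]
  set f : G.Dart → ℝ := fun e =>
    r * ((if e = α then (1 : ℝ) else 0) - if e = α.symm then 1 else 0) with hf
  set χ : G.Dart → ℝ := fun e => r * (p e.fst - p e.snd) with hχ
  have hfs : (fun e : G.Dart => f e.symm) = fun e => -f e := by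
    ext e
    have h1 : e.symm = α ↔ e = α.symm :=
      ⟨fun h => by rw [← h, SimpleGraph.Dart.symm_symm], fun h => by rw [h, SimpleGraph.Dart.symm_symm]⟩
    have h2 : e.symm = α.symm ↔ e = α := SimpleGraph.Dart.symm_involutive.injective.eq_iff
    simp only [hf, h1, h2]
    ring
  have hχs : (fun e : G.Dart => χ e.symm) = fun e => -χ e := by
    ext e
    simp only [hχ, SimpleGraph.Dart.symm, Prod.fst_swap, Prod.snd_swap]
    ring
  have hψ : (1 / (Real.sqrt 2 : ℂ)) • (ket hab - ket hab.symm) = realState f := by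
    rw [ket_eq_realState, ket_eq_realState]
    ext e
    simp [realState, hf, hr, hα, SimpleGraph.Dart.symm]
  have hout : ∀ u, outflow f u = outflow χ u := by
    intro u
    rw [hf, hχ, outflow_smul, outflow_smul, outflow_sub, outflow_single, outflow_single,
      outflow_eq fun v w => p v - p w, hp u]
    rfl
  -- The sum over darts counts each edge twice; `r² = 1/2` compensates.
  have hχ2 : ∑ e, χ e ^ 2 = p a - p b := by
    simp only [hχ, mul_pow, ← Finset.mul_sum, hp.energy, hr2]
    ring
  have hfx : ∀ x : G.Dart → ℝ, ∑ e, f e * x e = r * (x α - x α.symm) := by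
    intro x
    simp only [hf, mul_assoc, ← Finset.mul_sum, sub_mul, Finset.sum_sub_distrib, ite_mul, one_mul,
      zero_mul, Finset.sum_ite_eq', Finset.mem_univ, if_true]
  have h := oscillatesBetween_realState (degree_pos_of_adj_of_regular hG hab) hG hout
    (fun u => by rw [hfs, hχs, outflow_neg, outflow_neg, hout])
    (by
      rw [hfx, hχ2]
      have : χ α.symm = -χ α := congrFun hχs α
      rw [this]
      have h' : χ α = r * (p a - p b) := rfl
      rw [h']
      linear_combination 2 * (p a - p b) * hr2)
  have hf2 : ∑ e, f e ^ 2 = 1 := by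
    simp_rw [sq]
    rw [hfx]
    simp only [hf, if_true, if_neg hne, if_neg hne.symm]
    linear_combination 2 * hr2
  have hff : (fun e : G.Dart => -f e.symm) = f := by
    ext e
    rw [congrFun hfs e, neg_neg]
  rw [hff, hf2, hχ2] at h
  rw [hψ]
  exact h.isStationary

omit [DecidableEq V] in
theorem sum_neighborFinset_bipartiteDouble_inl [DecidableRel (bipartiteDouble G).Adj] (u : V)
    (F : V ⊕ V → ℝ) : ∑ w ∈ (bipartiteDouble G).neighborFinset (Sum.inl u), F w =
      ∑ w ∈ G.neighborFinset u, F (Sum.inr w) := by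
  rw [SimpleGraph.neighborFinset_eq_filter, SimpleGraph.neighborFinset_eq_filter,
    Finset.sum_filter, Finset.sum_filter, Fintype.sum_sum_type]
  have h1 : ∀ w, (bipartiteDouble G).Adj (Sum.inl u) (Sum.inl w) ↔ False := fun _ => Iff.rfl
  have h2 : ∀ w, (bipartiteDouble G).Adj (Sum.inl u) (Sum.inr w) ↔ G.Adj u w := fun _ => Iff.rfl
  simp [h1, h2]

omit [DecidableEq V] in
theorem sum_neighborFinset_bipartiteDouble_inr [DecidableRel (bipartiteDouble G).Adj] (v : V)
    (F : V ⊕ V → ℝ) : ∑ w ∈ (bipartiteDouble G).neighborFinset (Sum.inr v), F w =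
      ∑ w ∈ G.neighborFinset v, F (Sum.inl w) := by
  rw [SimpleGraph.neighborFinset_eq_filter, SimpleGraph.neighborFinset_eq_filter,
    Finset.sum_filter, Finset.sum_filter, Fintype.sum_sum_type]
  simp [bipartiteDouble, G.adj_comm]

/-- A dart `(u, v)` of `G` is the edge `{u_out, v_in}` of `G_b`. Kirchhoff's law at `u_out`
prescribes the outflow of `χ` at `u`, and at `v_in` its inflow at `v`, so the two can be matched to
`|ab⟩` independently. -/
theorem oscillatesBetween_of_potential [DecidableRel (bipartiteDouble G).Adj] {d : ℕ}
    (hG : G.IsRegularOfDegree d) {a b : V} (hab : G.Adj a b) {p : V ⊕ V → ℝ}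
    (hp : IsUnitCurrentPotential (bipartiteDouble G) (Sum.inl a) (Sum.inr b) p) :
    OscillatesBetween G d (1 - 2 * (p (Sum.inl a) - p (Sum.inr b))) (ket hab)
      (-ket hab.symm) := by
  set α : G.Dart := ⟨(a, b), hab⟩ with hα
  set f : G.Dart → ℝ := fun e => if e = α then (1 : ℝ) else 0 with hf
  set χ : G.Dart → ℝ := fun e => p (Sum.inl e.fst) - p (Sum.inr e.snd) with hχ
  have hfs : (fun e : G.Dart => f e.symm) = fun e => if e = α.symm then 1 else 0 := by
    ext e
    have h1 : e.symm = α ↔ e = α.symm :=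
      ⟨fun h => by rw [← h, SimpleGraph.Dart.symm_symm], fun h => by rw [h, SimpleGraph.Dart.symm_symm]⟩
    simp only [hf, h1]
  have hχs : (fun e : G.Dart => χ e.symm) =
      fun e => -(p (Sum.inr e.fst) - p (Sum.inl e.snd)) := by
    ext e
    simp only [hχ, SimpleGraph.Dart.symm, Prod.fst_swap, Prod.snd_swap]
    ring
  have hcur : ∀ u, outflow χ u = if u = a then 1 else 0 := by
    intro u
    have h := hp (Sum.inl u)
    rw [sum_neighborFinset_bipartiteDouble_inl] at h
    rw [hχ, outflow_eq fun v w => p (Sum.inl v) - p (Sum.inr w), h]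
    simp
  have hcur' : ∀ u, outflow (fun e => χ e.symm) u = if u = b then 1 else 0 := by
    intro u
    have h := hp (Sum.inr u)
    rw [sum_neighborFinset_bipartiteDouble_inr] at h
    rw [hχs, outflow_neg, outflow_eq fun v w => p (Sum.inr v) - p (Sum.inl w), h]
    simp
  have hpot : ∀ (x : V → ℝ) (g : G.Dart → ℝ), ∑ e, x e.fst * g e = ∑ u, x u * outflow g u := by
    intro x g
    simp only [outflow, Finset.mul_sum]
    rw [Finset.sum_comm]
    simp
  have hχ2 : ∑ e, χ e ^ 2 = p (Sum.inl a) - p (Sum.inr b) := by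
    -- The energy identity in `G_b`: the out-potential pairs with outflows and the in-potential with
    -- inflows. Darts of `G` meet each edge of `G_b` once, so no factor 2 appears.
    have e1 : ∀ e, χ e ^ 2 = p (Sum.inl e.fst) * χ e - p (Sum.inr e.snd) * χ e := fun e => by
      rw [sq, ← sub_mul]
    simp_rw [e1]
    rw [Finset.sum_sub_distrib, hpot fun u => p (Sum.inl u),
      ← sum_dart_symm G fun e => p (Sum.inr e.snd) * χ e]
    have e2 : ∑ e : G.Dart, p (Sum.inr e.symm.snd) * χ e.symm =
        ∑ u, p (Sum.inr u) * outflow (fun e => χ e.symm) u :=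
      hpot (fun u => p (Sum.inr u)) fun e => χ e.symm
    rw [e2]
    simp [hcur, hcur']
  have h := oscillatesBetween_realState (degree_pos_of_adj_of_regular hG hab) hG
    (f := f) (χ := χ) (fun u => by rw [hcur, hf, outflow_single])
    (fun u => by rw [hcur', hfs, outflow_single]; rfl)
    (by
      rw [hχ2]
      simp [hf, hχ, hα])
  have hf2 : ∑ e, f e ^ 2 = 1 := by simp [hf]
  have hket : (realState fun e : G.Dart => -f e.symm) = -ket hab.symm := by
    have hneg : (fun e : G.Dart => -f e.symm) = fun e => -(if e = α.symm then 1 else 0) :=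
      congrArg (fun (g : G.Dart → ℝ) e => -g e) hfs
    rw [hneg, ket_eq_realState]
    ext e
    simp only [realState, Complex.ofReal_neg]
    rfl
  rw [hf2, hχ2, hket] at h
  rw [ket_eq_realState hab]
  exact h

theorem IsStationary.mono {d : ℕ} {c c' : ℝ} {ψ : WalkSpace G}
    (h : IsStationary G d c ψ) (hc : c' ≤ c) : IsStationary G d c' ψ :=
  fun t => hc.trans (h t)

end Walk

end OscLoc

end

/-! ### Assembly of the resistance and localization bounds -/

theorem theorem6 :
    ∃ C : ℝ, 0 < C ∧
      -- resistance distance and edge-connectivity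
      (∀ (V : Type u) [Fintype V] [DecidableEq V] (G : SimpleGraph V) [DecidableRel G.Adj]
        (s t : V), s ≠ t → ∀ k : ℕ, 0 < k →
        (EdgeConnectedPair G s t k →
          (G.Adj s t ∨ (Fintype.card V : ℝ) ^ (2 / 3 : ℝ) ≤ k) →
          resistanceDist G s t ≤
            ENNReal.ofReal (C * (Fintype.card V : ℝ) ^ (2 / 3 : ℝ) / k)) ∧
        (∀ P : Fin k → G.Path s t, EdgeDisjoint P →
          resistanceDist G s t ≤ ENNReal.ofReal (parallelResistance P))) ∧
      -- localization of the walk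
      (∀ (V : Type u) [Fintype V] [DecidableEq V] (G : SimpleGraph V) [DecidableRel G.Adj]
        (d : ℕ), G.Connected → G.IsRegularOfDegree d →
        ∀ (a b : V) (hab : G.Adj a b) (k : ℕ), 0 < k →
        (EdgeConnectedPair (bipartiteDouble G) (Sum.inl a) (Sum.inr b) k →
          OscillatesBetween G d
            (1 - 2 * (C * (2 * (Fintype.card V : ℝ)) ^ (2 / 3 : ℝ) / k))
            (ket hab) (-ket hab.symm)) ∧
        (∀ P : Fin k → (bipartiteDouble G).Path (Sum.inl a) (Sum.inr b), EdgeDisjoint P →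
          OscillatesBetween G d (1 - 2 * parallelResistance P) (ket hab) (-ket hab.symm)) ∧
        (EdgeConnectedPair G a b k →
          IsStationary G d
            (1 - 2 * (C * (Fintype.card V : ℝ) ^ (2 / 3 : ℝ) / k))
            ((1 / (Real.sqrt 2 : ℂ)) • (ket hab - ket hab.symm))) ∧
        (∀ P : Fin k → G.Path a b, EdgeDisjoint P →
          IsStationary G d (1 - 2 * parallelResistance P)
            ((1 / (Real.sqrt 2 : ℂ)) • (ket hab - ket hab.symm)))) := by
  classical
  refine ⟨12, by norm_num, ?_, ?_⟩
  · intro V _ _ G _ s t hst k hk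
    refine ⟨fun h h' => ?_, fun P hP => ?_⟩
    · obtain ⟨P, hP⟩ := id h
      obtain ⟨p, hp⟩ := exists_isUnitCurrentPotential ⟨(P ⟨0, hk⟩).1⟩
      rw [resistanceDist_eq hp]
      exact ENNReal.ofReal_le_ofReal (hp.drop_le_of_edgeConnectedPair_of_adj_or hk h h')
    · obtain ⟨p, hp⟩ := exists_isUnitCurrentPotential ⟨(P ⟨0, hk⟩).1⟩
      rw [resistanceDist_eq hp]
      exact ENNReal.ofReal_le_ofReal (hp.drop_le_parallelResistance hst hk P hP)
  · intro V _ _ G _ d _ hG a b hab k hk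
    have hab' : (bipartiteDouble G).Adj (Sum.inl a) (Sum.inr b) := hab
    -- The edge `ab` and its lift to `G_b` already give both potentials, and they also provide the
    -- adjacency alternative, so no lower bound on `k` is needed below.
    obtain ⟨p, hp⟩ := exists_isUnitCurrentPotential hab.reachable
    obtain ⟨q, hq⟩ := exists_isUnitCurrentPotential hab'.reachable
    have hstat := isStationary_of_potential hG hab hp
    have hosc := oscillatesBetween_of_potential hG hab hq
    refine ⟨fun h => hosc.mono ?_, fun P hP => hosc.mono ?_, fun h => hstat.mono ?_,
      fun P hP => hstat.mono ?_⟩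
    · have := hq.drop_le_of_edgeConnectedPair_of_adj_or hk h (Or.inl hab')
      rw [Fintype.card_sum, Nat.cast_add, ← two_mul] at this
      linarith
    · linarith [hq.drop_le_parallelResistance Sum.inl_ne_inr hk P hP]
    · linarith [hp.drop_le_of_edgeConnectedPair_of_adj_or hk h (Or.inl hab)]
    · linarith [hp.drop_le_parallelResistance hab.ne hk P hP]
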